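/- Let $\mathbb{D}=\{z\in\mathbb{C}:|z|<1\}$. Let $\mathcal{H}^2(\mathbb{D})$ be the Hilbert space of analytic functions $g$ on $\mathbb{D}$ with $\|g\|^2=\sup_{0\le r<1}\frac{1}{2\pi}\int_{-\pi}^{\pi}|g(re^{i\theta})|^2\,d\theta<\infty$, and let $\mathcal{H}^\infty(\mathbb{D})$ be the set of bounded analytic functions on $\mathbb{D}$. For $\phi\in\mathcal{H}^\infty(\mathbb{D})$ let $M_\phi g=\phi g$ be the multiplication operator on $\mathcal{H}^2(\mathbb{D})$ and $M_\phi^*$ its adjoint. A function $h\in\mathcal{H}^2(\mathbb{D})$ is called outer if $\{ph : p \text{ a polynomial}\}$ is dense in $\mathcal{H}^2(\mathbb{D})$. Let $\phi$ be analytic on $\mathbb{D}$ and $z_0\in\mathbb{D}$. If $\phi(z)-\phi(z_0)=p(z)h(z)$ for all $z\in\mathbb{D}$, where $p$ is a monic polynomial all of whose roots lie in $\mathbb{D}$ and $h$ is analytic and without zeros on $\mathbb{D}$, then $h$ is called the roter function of $\phi$ at $z_0$ (such $p$ and $h$ are unique if they exist). A non-constant analytic function $\phi$ on $\mathbb{D}$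 is called $m$-folder if for every $z_0\in\mathbb{D}$ such a factorization exists, with $\deg p=m$ for every $z_0$. For a connected open set $\Omega\subseteq\mathbb{C}$ and $n\in\mathbb{N}$, let $\mathcal{B}_n(\Omega)$ be the set of bounded linear operators $T$ on a Hilbert space $\mathbb{H}$ such that (a) $\Omega\subseteq\sigma(T)$; (b) $\operatorname{ran}(T-\omega)=\mathbb{H}$ for every $\omega\in\Omega$; (c) the closed linear span of $\bigcup_{\omega\in\Omega}\ker(T-\omega)$ is $\mathbb{H}$; (d) $\dim\ker(T-\omega)=n$ for every $\omega\in\Omega$. A function $\phi\in\mathcal{H}^\infty(\mathbb{D})$ is called a Cowen–Douglas function if $M_\phi^*\in\mathcal{B}_n(\bar\phi(\mathbb{D}))$ for some $n\in\mathbb{N}$, where $\bar\phi(\mathbb{D})=\{\overline{\phi(z)}:z\in\mathbb{D}\}$. Theorem. Let $\phi\in\mathcal{H}^\infty(\mathbb{D})$ be an $m$-folder analytic function. If for every $z_0\in\mathbb{D}$ the roter function of $\phi$ at $z_0$ is outer, then $\phi$ is a Cowen–Douglas function; more precisely, $\bar\phi(\mathbb{D})$ is open and connected and $M_\phi^*\in\mathcal{B}_m(\bar\phi(\mathbb{D}))$.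 -/

import Mathlib

namespace Hardy

open Metric Set Real

theorem circleAverage_hasSum {u : ℕ → ℂ → ℂ} {F : ℂ → ℂ} {b : ℕ → ℝ} {r : ℝ}
    (hr : 0 ≤ r) (hu : ∀ n, Continuous (u n)) (hb : Summable b)
    (hub : ∀ n z, ‖z‖ = r → ‖u n z‖ ≤ b n)
    (hF : ∀ z, ‖z‖ = r → HasSum (fun n => u n z) (F z)) :
    HasSum (fun n => circleAverage (u n) 0 r) (circleAverage F 0 r) := by
  have hn : ∀ θ : ℝ, ‖circleMap 0 r θ‖ = r := fun θ => by simp [abs_of_nonneg hr]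
  unfold circleAverage
  apply HasSum.const_smul
  refine intervalIntegral.hasSum_integral_of_dominated_convergence (fun n _ => b n)
    (fun n => ((hu n).comp (continuous_circleMap 0 r)).aestronglyMeasurable) ?_ ?_ ?_ ?_
  · exact fun n => Filter.Eventually.of_forall fun θ _ => hub n _ (hn θ)
  · exact Filter.Eventually.of_forall fun θ _ => hb
  · exact intervalIntegrable_const
  · exact Filter.Eventually.of_forall fun θ _ => hF _ (hn θ)

theorem circleAverage_conj_pow_mul_pow (r : ℝ) (m n : ℕ) :
    circleAverage (fun z => (starRingEnd ℂ) z ^ m * z ^ n) 0 r =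
      if n = m then (r : ℂ) ^ (2 * m) else 0 := by
  have h : ∀ θ : ℝ, (starRingEnd ℂ) (circleMap 0 r θ) ^ m * (circleMap 0 r θ) ^ n =
      (r : ℂ) ^ (m + n) * Complex.exp (((n : ℂ) - m) * Complex.I * θ) := by
    intro θ
    simp only [circleMap, zero_add, map_mul, Complex.conj_ofReal, ← Complex.exp_conj, mul_pow,
      Complex.conj_I, ← Complex.exp_nat_mul]
    have : Complex.exp (((n : ℂ) - m) * Complex.I * θ) =
      Complex.exp (m * (θ * -Complex.I)) * Complex.exp (n * (θ * Complex.I)) := by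
      rw [← Complex.exp_add]; ring_nf
    rw [this]; ring
  simp only [circleAverage, h]
  rw [intervalIntegral.integral_const_mul]
  split_ifs with hnm
  · subst hnm
    simp only [sub_self, zero_mul, Complex.exp_zero, intervalIntegral.integral_const, sub_zero]
    have : (π : ℂ) ≠ 0 := by exact_mod_cast Real.pi_ne_zero
    simp only [Complex.real_smul]
    push_cast
    field_simp
    ring
  · have hc : ((n : ℂ) - m) * Complex.I ≠ 0 := by
      refine mul_ne_zero (sub_ne_zero.2 ?_) Complex.I_ne_zero
      exact_mod_cast hnm
    rw [integral_exp_mul_complex hc]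
    have : Complex.exp (((n : ℂ) - m) * Complex.I * ((2 * π : ℝ) : ℂ)) = 1 := by
      rw [Complex.exp_eq_one_iff]
      exact ⟨(n : ℤ) - m, by push_cast; ring⟩
    rw [this]; simp

/-- `a` is the sequence of Taylor coefficients of `f` on the unit disc. -/
def HasCoeff (f : ℂ → ℂ) (a : ℕ → ℂ) : Prop :=
  ∀ z ∈ ball (0 : ℂ) 1, HasSum (fun n => a n * z ^ n) (f z)

theorem HasCoeff.summable {f : ℂ → ℂ} {a : ℕ → ℂ} (h : HasCoeff f a) {r : ℝ} (hr : 0 ≤ r)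
    (hr1 : r < 1) : Summable fun n => ‖a n‖ * r ^ n := by
  have := (h (r : ℂ) (by simpa [abs_of_nonneg hr] using hr1)).summable.norm
  simpa [abs_of_nonneg hr] using this

theorem HasCoeff.circleAverage_conj_pow_mul {f : ℂ → ℂ} {a : ℕ → ℂ} (h : HasCoeff f a) {r : ℝ}
    (hr : 0 ≤ r) (hr1 : r < 1) (m : ℕ) :
    circleAverage (fun z => (starRingEnd ℂ) z ^ m * f z) 0 r = a m * (r : ℂ) ^ (2 * m) := by
  have h1 : HasSum
      (fun n => circleAverage (fun z => (starRingEnd ℂ) z ^ m * (a n * z ^ n)) 0 r)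
      (circleAverage (fun z => (starRingEnd ℂ) z ^ m * f z) 0 r) := by
    refine circleAverage_hasSum (b := fun n => r ^ m * (‖a n‖ * r ^ n)) hr
      (fun n => by fun_prop) ((h.summable hr hr1).mul_left _) ?_ ?_
    · intro n z hz; simp [hz]
    · intro z hz
      exact (h z (by simpa [hz] using hr1)).mul_left _
  refine h1.unique ?_
  have h2 : ∀ n, circleAverage (fun z => (starRingEnd ℂ) z ^ m * (a n * z ^ n)) 0 r =
      if n = m then a m * (r : ℂ) ^ (2 * m) else 0 := by
    intro n
    have : (fun z : ℂ => (starRingEnd ℂ) z ^ m * (a n * z ^ n)) =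
        fun z => a n • ((starRingEnd ℂ) z ^ m * z ^ n) := by
      ext z; simp only [smul_eq_mul]; ring
    rw [this, circleAverage_fun_smul, circleAverage_conj_pow_mul_pow]
    split_ifs with hnm
    · rw [hnm]; rfl
    · simp
  simp only [h2]
  exact hasSum_ite_eq m _

theorem HasCoeff.unique {f : ℂ → ℂ} {a b : ℕ → ℂ} (ha : HasCoeff f a) (hb : HasCoeff f b) :
    a = b := by
  ext m
  have h1 := ha.circleAverage_conj_pow_mul (r := 1 / 2) (by norm_num) (by norm_num) m
  rw [hb.circleAverage_conj_pow_mul (r := 1 / 2) (by norm_num) (by norm_num) m] at h1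
  refine (mul_right_cancel₀ (pow_ne_zero _ ?_) h1).symm
  norm_num

/-- Parseval's identity on the circle of radius `r`. -/
theorem HasCoeff.hasSum_circleAverage {f : ℂ → ℂ} {a : ℕ → ℂ} (h : HasCoeff f a)
    (hf : DifferentiableOn ℂ f (ball 0 1)) {r : ℝ} (hr : 0 ≤ r) (hr1 : r < 1) :
    HasSum (fun n => ‖a n‖ ^ 2 * r ^ (2 * n)) (circleAverage (fun z => ‖f z‖ ^ 2) 0 r) := by
  have hsub : sphere (0 : ℂ) |r| ⊆ ball 0 1 := by
    intro z hz
    simp only [mem_sphere_iff_norm, sub_zero, abs_of_nonneg hr] at hz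
    simpa [hz] using hr1
  obtain ⟨C, hC⟩ : ∃ C, ∀ z ∈ sphere (0 : ℂ) |r|, ‖f z‖ ≤ C :=
    (isCompact_sphere 0 |r|).exists_bound_of_continuousOn (hf.continuousOn.mono hsub)
  set g : ℝ → ℂ := fun θ => f (circleMap 0 r θ) with hg
  have hmem : ∀ θ : ℝ, circleMap 0 r θ ∈ sphere (0 : ℂ) |r| := fun θ => by simp
  have hgc : Continuous g :=
    (hf.continuousOn.mono hsub).comp_continuous (continuous_circleMap 0 r) hmem
  have hn : ∀ θ : ℝ, ‖circleMap 0 r θ‖ = r := fun θ => by simp [abs_of_nonneg hr]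
  -- expand one factor
  have h1 : HasSum
      (fun n => circleAverage (fun z => (starRingEnd ℂ) (a n) * ((starRingEnd ℂ) z ^ n * f z)) 0 r)
      (circleAverage (fun z => (starRingEnd ℂ) (f z) * f z) 0 r) := by
    unfold circleAverage
    apply HasSum.const_smul
    refine intervalIntegral.hasSum_integral_of_dominated_convergence
      (fun n _ => ‖a n‖ * r ^ n * C) (fun n => ?_) ?_ ?_ ?_ ?_
    · refine Continuous.aestronglyMeasurable ?_
      have : Continuous fun θ => (starRingEnd ℂ) (a n) *
          ((starRingEnd ℂ) (circleMap 0 r θ) ^ n * g θ) := by fun_prop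
      exact this
    · refine fun n => Filter.Eventually.of_forall fun θ _ => ?_
      simp only [norm_mul, RCLike.norm_conj, norm_pow, hn]
      rw [mul_assoc]
      have := hC _ (hmem θ)
      gcongr
    · exact Filter.Eventually.of_forall fun θ _ => (h.summable hr hr1).mul_right _
    · exact intervalIntegrable_const
    · refine Filter.Eventually.of_forall fun θ _ => ?_
      have h2 := (((h _ (hsub (hmem θ))).map (starRingEnd ℂ) Complex.continuous_conj).mul_right
        (f (circleMap 0 r θ)))
      simpa [Function.comp_def, mul_assoc] using h2
  have h3 : ∀ n, circleAverage
      (fun z => (starRingEnd ℂ) (a n) * ((starRingEnd ℂ) z ^ n * f z)) 0 r =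
        ((‖a n‖ ^ 2 * r ^ (2 * n) : ℝ) : ℂ) := by
    intro n
    have := circleAverage_fun_smul (a := (starRingEnd ℂ) (a n)) (c := (0 : ℂ)) (R := r)
      (f := fun z => (starRingEnd ℂ) z ^ n * f z)
    simp only [smul_eq_mul] at this
    rw [this, h.circleAverage_conj_pow_mul hr hr1, ← mul_assoc, ← Complex.normSq_eq_conj_mul_self,
      Complex.normSq_eq_norm_sq]
    push_cast; ring
  have h4 : circleAverage (fun z => (starRingEnd ℂ) (f z) * f z) 0 r =
      ((circleAverage (fun z => ‖f z‖ ^ 2) 0 r : ℝ) : ℂ) := by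
    have : (fun z => (starRingEnd ℂ) (f z) * f z) = fun z => ((‖f z‖ ^ 2 : ℝ) : ℂ) := by
      ext z; rw [← Complex.normSq_eq_conj_mul_self, Complex.normSq_eq_norm_sq]
    rw [this]
    simp only [circleAverage, intervalIntegral.integral_ofReal, Complex.real_smul, smul_eq_mul]
    push_cast; rfl
  simp only [h3, h4] at h1
  exact_mod_cast h1

theorem hasCoeff_taylor {f : ℂ → ℂ} (hf : DifferentiableOn ℂ f (ball 0 1)) :
    HasCoeff f fun n => (n.factorial : ℂ)⁻¹ * iteratedDeriv n f 0 := by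
  intro z hz
  have := Complex.hasSum_taylorSeries_on_ball (r := 1) (f := f) (c := 0) (by simpa using hf)
    (by simpa using hz)
  simp only [sub_zero, smul_eq_mul] at this
  have h : (fun n : ℕ => (n.factorial : ℂ)⁻¹ * iteratedDeriv n f 0 * z ^ n) =
      fun n : ℕ => (n.factorial : ℂ)⁻¹ * (z ^ n * iteratedDeriv n f 0) := by
    funext n; ring
  rw [h]
  exact this

/-- The integral means of `|f|²` over the circles of radius `r < 1`. -/
def sqMeans (f : ℂ → ℂ) : Set ℝ :=
  (fun r : ℝ => circleAverage (fun z => ‖f z‖ ^ 2) 0 r) '' Ico 0 1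

theorem HasCoeff.summable_sq {f : ℂ → ℂ} {a : ℕ → ℂ} (h : HasCoeff f a)
    (hf : DifferentiableOn ℂ f (ball 0 1)) {C : ℝ} (hC : C ∈ upperBounds (sqMeans f)) :
    Summable (fun n => ‖a n‖ ^ 2) ∧ ∑' n, ‖a n‖ ^ 2 ≤ C := by
  have key : ∀ s : Finset ℕ, ∑ n ∈ s, ‖a n‖ ^ 2 ≤ C := by
    intro s
    have hc : Continuous fun r : ℝ => ∑ n ∈ s, ‖a n‖ ^ 2 * r ^ (2 * n) := by fun_prop
    have ht : Filter.Tendsto (fun r : ℝ => ∑ n ∈ s, ‖a n‖ ^ 2 * r ^ (2 * n))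
        (nhdsWithin 1 (Iio 1)) (nhds (∑ n ∈ s, ‖a n‖ ^ 2)) := by
      have := (hc.tendsto 1).mono_left (nhdsWithin_le_nhds (s := Iio 1))
      simpa using this
    refine le_of_tendsto ht ?_
    filter_upwards [Ioo_mem_nhdsLT (show (0 : ℝ) < 1 by norm_num)] with r hr
    have hs := h.hasSum_circleAverage hf hr.1.le hr.2
    have hr0 := hr.1.le
    refine (sum_le_hasSum s (fun n _ => by positivity) hs).trans (hC ⟨r, ⟨hr.1.le, hr.2⟩, rfl⟩)
  have hs : Summable (fun n => ‖a n‖ ^ 2) :=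
    summable_of_sum_le (fun n => by positivity) key
  exact ⟨hs, hs.tsum_le_of_sum_le key⟩

theorem HasCoeff.isLUB_sqMeans {f : ℂ → ℂ} {a : ℕ → ℂ} (h : HasCoeff f a)
    (hf : DifferentiableOn ℂ f (ball 0 1)) (ha : Summable fun n => ‖a n‖ ^ 2) :
    IsLUB (sqMeans f) (∑' n, ‖a n‖ ^ 2) := by
  refine ⟨?_, fun C hC => (h.summable_sq hf hC).2⟩
  rintro _ ⟨r, hr, rfl⟩
  have hs := h.hasSum_circleAverage hf hr.1 hr.2
  refine hasSum_le (fun n => ?_) hs ha.hasSum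
  have : r ^ (2 * n) ≤ 1 := pow_le_one₀ hr.1 hr.2.le
  nlinarith [sq_nonneg ‖a n‖]

theorem HasCoeff.bddAbove_iff {f : ℂ → ℂ} {a : ℕ → ℂ} (h : HasCoeff f a)
    (hf : DifferentiableOn ℂ f (ball 0 1)) :
    BddAbove (sqMeans f) ↔ Summable fun n => ‖a n‖ ^ 2 :=
  ⟨fun ⟨_, hC⟩ => (h.summable_sq hf hC).1, fun ha => ⟨_, (h.isLUB_sqMeans hf ha).1⟩⟩

theorem HasCoeff.add {f g : ℂ → ℂ} {a b : ℕ → ℂ} (hf : HasCoeff f a) (hg : HasCoeff g b) :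
    HasCoeff (f + g) (a + b) := fun z hz => by
  simpa [add_mul] using (hf z hz).add (hg z hz)

theorem HasCoeff.smul {f : ℂ → ℂ} {a : ℕ → ℂ} (c : ℂ) (hf : HasCoeff f a) :
    HasCoeff (c • f) (c • a) := fun z hz => by
  simpa [mul_assoc] using (hf z hz).mul_left c

theorem summable_sq_iff {a : ℕ → ℂ} : (Summable fun n => ‖a n‖ ^ 2) ↔ Memℓp a 2 := by
  rw [memℓp_gen_iff (by norm_num)]
  simp

/-- The analytic functions on the unit disc whose square means over the circles of radius `r < 1`
are bounded. As only the values on the disc matter, the functions are normalised to vanish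
outside of it. -/
def h2Submodule : Submodule ℂ (ℂ → ℂ) where
  carrier := {f | DifferentiableOn ℂ f (ball 0 1) ∧ (∀ z ∉ ball (0 : ℂ) 1, f z = 0) ∧
    BddAbove (sqMeans f)}
  zero_mem' := by
    refine ⟨differentiableOn_const 0, fun _ _ => rfl, 0, ?_⟩
    rintro _ ⟨r, -, rfl⟩
    simp [circleAverage]
  add_mem' := by
    rintro f g ⟨hf, hf0, hfb⟩ ⟨hg, hg0, hgb⟩
    refine ⟨hf.add hg, fun z hz => by simp [hf0 z hz, hg0 z hz], ?_⟩
    rw [(hasCoeff_taylor hf).bddAbove_iff hf, summable_sq_iff] at hfb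
    rw [(hasCoeff_taylor hg).bddAbove_iff hg, summable_sq_iff] at hgb
    rw [((hasCoeff_taylor hf).add (hasCoeff_taylor hg)).bddAbove_iff (hf.add hg), summable_sq_iff]
    exact hfb.add hgb
  smul_mem' := by
    rintro c f ⟨hf, hf0, hfb⟩
    refine ⟨hf.const_smul c, fun z hz => by simp [hf0 z hz], ?_⟩
    rw [(hasCoeff_taylor hf).bddAbove_iff hf, summable_sq_iff] at hfb
    rw [((hasCoeff_taylor hf).smul c).bddAbove_iff (hf.const_smul c), summable_sq_iff]
    exact hfb.const_smul c

/-- The Hardy space `H²(𝔻)` as a vector space of functions. -/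
def H2 : Type := h2Submodule

namespace H2

noncomputable instance : AddCommGroup H2 := inferInstanceAs (AddCommGroup h2Submodule)
noncomputable instance : Module ℂ H2 := inferInstanceAs (Module ℂ h2Submodule)

instance : FunLike H2 ℂ ℂ where
  coe f := f.1
  coe_injective _ _ h := Subtype.ext h

theorem differentiableOn (f : H2) : DifferentiableOn ℂ f (ball 0 1) := f.2.1

theorem eq_zero_of_notMem (f : H2) {z : ℂ} (hz : z ∉ ball (0 : ℂ) 1) : f z = 0 := f.2.2.1 z hz

theorem bddAbove (f : H2) : BddAbove (sqMeans f) := f.2.2.2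

/-- The Taylor coefficients at `0`. -/
noncomputable def coeff (f : H2) (n : ℕ) : ℂ := (n.factorial : ℂ)⁻¹ * iteratedDeriv n f 0

theorem hasCoeff (f : H2) : HasCoeff f f.coeff := hasCoeff_taylor f.differentiableOn

theorem summable_coeff (f : H2) : Summable fun n => ‖f.coeff n‖ ^ 2 :=
  (f.hasCoeff.bddAbove_iff f.differentiableOn).1 f.bddAbove

@[ext] theorem ext_ball {f g : H2} (h : ∀ z ∈ ball (0 : ℂ) 1, f z = g z) : f = g := by
  refine DFunLike.ext _ _ fun z => ?_
  by_cases hz : z ∈ ball (0 : ℂ) 1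
  · exact h z hz
  · rw [f.eq_zero_of_notMem hz, g.eq_zero_of_notMem hz]

@[simp] theorem add_apply (f g : H2) (z : ℂ) : (f + g) z = f z + g z := rfl
@[simp] theorem smul_apply (c : ℂ) (f : H2) (z : ℂ) : (c • f) z = c * f z := rfl

theorem coeff_add (f g : H2) : (f + g).coeff = f.coeff + g.coeff :=
  (f + g).hasCoeff.unique (f.hasCoeff.add g.hasCoeff)

theorem coeff_smul (c : ℂ) (f : H2) : (c • f).coeff = c • f.coeff :=
  (c • f).hasCoeff.unique (f.hasCoeff.smul c)

/-- The map sending a function to its square summable sequence of Taylor coefficients. -/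
noncomputable def toSeq : H2 →ₗ[ℂ] lp (fun _ : ℕ => ℂ) 2 where
  toFun f := ⟨f.coeff, summable_sq_iff.1 f.summable_coeff⟩
  map_add' f g := Subtype.ext (coeff_add f g)
  map_smul' c f := Subtype.ext (coeff_smul c f)

theorem toSeq_injective : Function.Injective toSeq := by
  intro f g h
  have hc : f.coeff = g.coeff := congrArg Subtype.val h
  ext z hz
  have h1 := f.hasCoeff z hz
  rw [hc] at h1
  exact h1.unique (g.hasCoeff z hz)

/-- `‖f‖² = sup_{r < 1} (1 / 2π) ∫_0^{2π} |f(r e^{iθ})|² dθ`. -/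
noncomputable instance : Norm H2 := ⟨fun f => √(sSup (sqMeans f))⟩

theorem norm_eq (f : H2) : ‖f‖ = √(sSup (sqMeans f)) := rfl

theorem norm_sq_eq_tsum (f : H2) : ‖f‖ ^ 2 = ∑' n, ‖f.coeff n‖ ^ 2 := by
  have h := f.hasCoeff.isLUB_sqMeans f.differentiableOn f.summable_coeff
  rw [norm_eq, h.csSup_eq ⟨_, 0, by simp, rfl⟩, Real.sq_sqrt]
  exact tsum_nonneg fun n => by positivity

theorem norm_toSeq (f : H2) : ‖toSeq f‖ = ‖f‖ := by
  have h1 : ‖toSeq f‖ ^ 2 = ‖f‖ ^ 2 := by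
    rw [norm_sq_eq_tsum]
    have := lp.norm_rpow_eq_tsum (p := 2) (by norm_num) (toSeq f)
    simpa [toSeq] using this
  exact (pow_left_inj₀ (norm_nonneg _) (Real.sqrt_nonneg _) two_ne_zero).1 h1

theorem core : NormedSpace.Core ℂ H2 where
  norm_nonneg f := Real.sqrt_nonneg _
  norm_smul c f := by rw [← norm_toSeq, ← norm_toSeq, map_smul, norm_smul]
  norm_triangle f g := by
    rw [← norm_toSeq, ← norm_toSeq, ← norm_toSeq, map_add]; exact norm_add_le _ _
  norm_eq_zero_iff f := by
    rw [← norm_toSeq, norm_eq_zero, map_eq_zero_iff _ toSeq_injective]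

noncomputable instance : NormedAddCommGroup H2 := NormedAddCommGroup.ofCore core

/-- The inner product that induces the norm, `⟪f, g⟫ = ∑ conj (aₙ) bₙ` in the Taylor
coefficients. -/
noncomputable instance : InnerProductSpace ℂ H2 where
  toNormedSpace := NormedSpace.ofCore core
  inner f g := inner ℂ (toSeq f) (toSeq g)
  norm_sq_eq_re_inner f := by
    rw [← norm_toSeq]; exact norm_sq_eq_re_inner (𝕜 := ℂ) (toSeq f)
  conj_inner_symm f g := inner_conj_symm _ _
  add_left f g k := by rw [map_add, inner_add_left]
  smul_left f g c := by rw [map_smul, inner_smul_left]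

/-- The function with given Taylor coefficients. -/
noncomputable def seriesFun (a : ℕ → ℂ) : ℂ → ℂ :=
  (ball (0 : ℂ) 1).indicator fun z => ∑' n, a n * z ^ n

theorem summable_of_sq {a : ℕ → ℂ} (ha : Summable fun n => ‖a n‖ ^ 2) {r : ℝ} (hr : 0 ≤ r)
    (hr1 : r < 1) : Summable fun n => ‖a n‖ * r ^ n := by
  have h2 : Summable fun n : ℕ => (r ^ 2) ^ n :=
    summable_geometric_of_lt_one (by positivity) (by nlinarith)
  refine Summable.of_nonneg_of_le (fun n => by positivity) (fun n => ?_) (ha.add h2)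
  have : (r ^ 2) ^ n = (r ^ n) ^ 2 := by ring
  rw [this]
  nlinarith [sq_nonneg (‖a n‖ - r ^ n), sq_nonneg (‖a n‖), sq_nonneg (r ^ n)]

theorem hasCoeff_seriesFun {a : ℕ → ℂ} (ha : Summable fun n => ‖a n‖ ^ 2) :
    HasCoeff (seriesFun a) a := by
  intro z hz
  rw [seriesFun, indicator_of_mem hz]
  refine Summable.hasSum (Summable.of_norm ?_)
  simpa using summable_of_sq ha (norm_nonneg z) (by simpa using hz)

theorem differentiableOn_seriesFun {a : ℕ → ℂ} (ha : Summable fun n => ‖a n‖ ^ 2) :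
    DifferentiableOn ℂ (seriesFun a) (ball 0 1) := by
  intro z hz
  obtain ⟨r, hzr, hr1⟩ := exists_between (show ‖z‖ < 1 by simpa using hz)
  have hr : 0 ≤ r := (norm_nonneg z).trans hzr.le
  have hd : DifferentiableOn ℂ (fun w => ∑' n, a n * w ^ n) (ball 0 r) := by
    refine Complex.differentiableOn_tsum_of_summable_norm (summable_of_sq ha hr hr1)
      (fun n => by fun_prop) isOpen_ball fun n w hw => ?_
    have hw' : ‖w‖ ≤ r := by simpa using (mem_ball_zero_iff.1 hw).le
    rw [norm_mul, norm_pow]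
    gcongr
  have hz' : z ∈ ball (0 : ℂ) r := by simpa using hzr
  refine DifferentiableAt.differentiableWithinAt ?_
  refine ((hd z hz').differentiableAt (isOpen_ball.mem_nhds hz')).congr_of_eventuallyEq ?_
  filter_upwards [isOpen_ball.mem_nhds hz] with w hw
  rw [seriesFun, indicator_of_mem hw]

theorem toSeq_surjective : Function.Surjective toSeq := by
  intro a
  have ha : Summable fun n => ‖a n‖ ^ 2 := summable_sq_iff.2 a.2
  have hd := differentiableOn_seriesFun ha
  have hc := hasCoeff_seriesFun ha
  let f : H2 := ⟨seriesFun a, hd, fun z hz => indicator_of_notMem hz _, (hc.bddAbove_iff hd).2 ha⟩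
  exact ⟨f, Subtype.ext (f.hasCoeff.unique hc)⟩

/-- The isometric isomorphism of `H²(𝔻)` with the square summable sequences. -/
noncomputable def toSeqEquiv : H2 ≃ₗᵢ[ℂ] lp (fun _ : ℕ => ℂ) 2 where
  toLinearEquiv := LinearEquiv.ofBijective toSeq ⟨toSeq_injective, toSeq_surjective⟩
  norm_map' := norm_toSeq

instance : CompleteSpace H2 := toSeqEquiv.toIsometryEquiv.completeSpace

end H2

/-- `φ ∈ H^∞(𝔻)`: a bounded analytic function on the unit disc. Only the values of `φ` on the
disc matter. -/
structure IsHInfty (φ : ℂ → ℂ) : Prop where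
  differentiableOn : DifferentiableOn ℂ φ (ball 0 1)
  bounded : ∃ C : ℝ, ∀ z ∈ ball (0 : ℂ) 1, ‖φ z‖ ≤ C

theorem sqMeans_mul_le {φ : ℂ → ℂ} (hφ : DifferentiableOn ℂ φ (ball 0 1)) {C : ℝ}
    (hC : ∀ z ∈ ball (0 : ℂ) 1, ‖φ z‖ ≤ C) (f : H2) :
    C ^ 2 * sSup (sqMeans f) ∈ upperBounds (sqMeans fun z => φ z * f z) := by
  rintro _ ⟨r, hr, rfl⟩
  have hsub : sphere (0 : ℂ) |r| ⊆ ball 0 1 := by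
    intro z hz
    simp only [mem_sphere_iff_norm, sub_zero, abs_of_nonneg hr.1] at hz
    simpa [hz] using hr.2
  have h1 : circleAverage (fun z => ‖φ z * f z‖ ^ 2) 0 r ≤
      circleAverage (fun z => C ^ 2 • ‖f z‖ ^ 2) 0 r := by
    refine circleAverage_mono ?_ ?_ fun z hz => ?_
    · refine ContinuousOn.circleIntegrable' ?_
      exact (((hφ.mul f.differentiableOn).continuousOn.mono hsub).norm.pow 2)
    · refine ContinuousOn.circleIntegrable' ?_
      exact ((f.differentiableOn.continuousOn.mono hsub).norm.pow 2).const_smul (C ^ 2)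
    · rw [norm_mul, mul_pow, smul_eq_mul]
      have := hC z (hsub hz)
      gcongr
  refine h1.trans ?_
  rw [circleAverage_fun_smul, smul_eq_mul]
  exact mul_le_mul_of_nonneg_left (le_csSup f.bddAbove ⟨r, hr, rfl⟩) (sq_nonneg C)

/-- The multiplication operator `M_φ f = φ f` on `H²(𝔻)`. -/
noncomputable def mulOp (φ : ℂ → ℂ) (hφ : IsHInfty φ) : H2 →L[ℂ] H2 :=
  LinearMap.mkContinuousOfExistsBound
    { toFun := fun f => ⟨fun z => φ z * f z, hφ.differentiableOn.mul f.differentiableOn,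
        fun z hz => by simp [f.eq_zero_of_notMem hz],
        ⟨_, sqMeans_mul_le hφ.differentiableOn hφ.bounded.choose_spec f⟩⟩
      map_add' := fun f g => H2.ext_ball fun z _ => mul_add (φ z) (f z) (g z)
      map_smul' := fun c f => H2.ext_ball fun z _ => mul_left_comm (φ z) c (f z) }
    (by
      obtain ⟨C, hC⟩ := hφ.bounded
      refine ⟨|C|, fun f => ?_⟩
      have h := csSup_le (s := sqMeans fun z => φ z * f z) ⟨_, 0, by simp, rfl⟩
        (sqMeans_mul_le hφ.differentiableOn hC f)
      refine (Real.sqrt_le_sqrt h).trans_eq ?_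
      rw [Real.sqrt_mul (sq_nonneg C), Real.sqrt_sq_eq_abs, H2.norm_eq])

@[simp] theorem mulOp_apply (φ : ℂ → ℂ) (hφ : IsHInfty φ) (f : H2) (z : ℂ) :
    mulOp φ hφ f z = φ z * f z := rfl

/-- `h` is an outer function: it belongs to `H²(𝔻)`, and the products of `h` with the polynomials
are dense in `H²(𝔻)`. -/
def IsOuter (h : ℂ → ℂ) : Prop :=
  (∃ g : H2, ∀ z ∈ ball (0 : ℂ) 1, g z = h z) ∧
    Dense {g : H2 | ∃ p : Polynomial ℂ, ∀ z ∈ ball (0 : ℂ) 1, g z = p.eval z * h z}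

/-- `φ - φ z₀ = p * h` on the unit disc, where `p` is a monic polynomial with all its roots in the
disc and `h` is analytic without zeros on the disc. Then `h` is the roter function of `φ` at
`z₀`. -/
structure IsRoterFactorization (φ : ℂ → ℂ) (z₀ : ℂ) (p : Polynomial ℂ) (h : ℂ → ℂ) : Prop where
  monic : p.Monic
  root_mem : ∀ z, p.IsRoot z → z ∈ ball (0 : ℂ) 1
  differentiableOn : DifferentiableOn ℂ h (ball 0 1)
  ne_zero : ∀ z ∈ ball (0 : ℂ) 1, h z ≠ 0
  eq_mul : ∀ z ∈ ball (0 : ℂ) 1, φ z - φ z₀ = p.eval z * h z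

/-- `h` is the roter function of `φ` at `z₀` (it is unique on the disc, if it exists). -/
def IsRoterFunction (φ : ℂ → ℂ) (z₀ : ℂ) (h : ℂ → ℂ) : Prop :=
  ∃ p : Polynomial ℂ, IsRoterFactorization φ z₀ p h

/-- `φ` is an `m`-folder analytic function on the unit disc. -/
structure IsFolder (m : ℕ) (φ : ℂ → ℂ) : Prop where
  differentiableOn : DifferentiableOn ℂ φ (ball 0 1)
  nonconstant : ∃ z ∈ ball (0 : ℂ) 1, ∃ w ∈ ball (0 : ℂ) 1, φ z ≠ φ w
  factorization : ∀ z₀ ∈ ball (0 : ℂ) 1, ∃ (p : Polynomial ℂ) (h : ℂ → ℂ),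
    IsRoterFactorization φ z₀ p h ∧ p.natDegree = m

/-- The Cowen-Douglas class `𝓑ₙ(Ω)` of bounded operators on the Hilbert space `E`, where `Ω` is a
connected open subset of the plane. -/
structure IsCowenDouglas {E : Type*} [NormedAddCommGroup E] [InnerProductSpace ℂ E]
    (n : ℕ) (Ω : Set ℂ) (T : E →L[ℂ] E) : Prop where
  isOpen : IsOpen Ω
  isConnected : IsConnected Ω
  subset_spectrum : Ω ⊆ spectrum ℂ T
  range_eq_top : ∀ ω ∈ Ω, (T - ω • ContinuousLinearMap.id ℂ E).range = ⊤
  closure_span_ker : (⨆ ω ∈ Ω,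
    (T - ω • ContinuousLinearMap.id ℂ E).ker).topologicalClosure = ⊤
  rank_ker : ∀ ω ∈ Ω,
    Module.rank ℂ (T - ω • ContinuousLinearMap.id ℂ E).ker = n

/-- The set `{conj (φ z) : z ∈ 𝔻}`. -/
def conjImage (φ : ℂ → ℂ) : Set ℂ := (fun z => (starRingEnd ℂ) (φ z)) '' ball 0 1

/-- `φ` is a Cowen-Douglas function. -/
def IsCowenDouglasFunction (φ : ℂ → ℂ) (hφ : IsHInfty φ) : Prop :=
  ∃ n : ℕ, IsCowenDouglas n (conjImage φ) (ContinuousLinearMap.adjoint (mulOp φ hφ))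

end Hardy

namespace Hardy

open Metric Set Real

/-! The heart of the matter is that an `m`-folder function is proper onto its image. All `m` zeros
of `φ - φ z₀`, counted with multiplicity, lie inside some circle `|z| = ρ < 1`. By the argument
principle, a value close to `φ z₀` is also taken `m` times inside that circle. Since it is taken
exactly `m` times on the disc, it is not taken for `|z| ≥ ρ`. So `|φ - φ z₀|` is bounded below near
the unit circle (`IsFolder.exists_le_norm_sub`), and in `φ - φ z₀ = p h` both `h` and `1/h` are
bounded (`IsRoterFactorization.isHInfty`, `IsFolder.isHInfty_inv`).

Therefore the adjoint of multiplication by `φ - φ z₀` is `M_h^* M_p^*` with `M_h^*` invertible, and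
only `p` matters. For a linear factor, `M_{z-a}` is bounded below because `M_z` is an isometry, so
its adjoint is surjective; the kernel of that adjoint is the line through the reproducing kernel at
`a`. Kernel dimensions add under composition with a surjective map (`rank_ker_comp_of_surjective`),
so `M_p^*` is surjective with kernel of dimension `deg p = m`.

Finally, the reproducing kernel at `z₀` is an eigenvector of `M_φ^*` for the conjugate of `φ z₀`.
This gives the spectral inclusion, and also the density of the eigenspaces, since a function
orthogonal to every reproducing kernel vanishes. -/

/-! ### The argument principle and properness of folder functions. -/

/-- The argument principle for a product of linear factors and a zero-free function. -/
theorem circleIntegral_logDeriv_prod_mul {h : ℂ → ℂ} (hh : DifferentiableOn ℂ h (ball 0 1))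
    (h0 : ∀ z ∈ ball (0 : ℂ) 1, h z ≠ 0) {ρ : ℝ} (hρ : 0 ≤ ρ) (hρ1 : ρ < 1) (s : Multiset ℂ)
    (hs : ∀ a ∈ s, ‖a‖ ≠ ρ) :
    (∮ z in C(0, ρ), logDeriv (fun z => (s.map fun a => z - a).prod * h z) z) =
      (s.filter fun a => ‖a‖ < ρ).card * (2 * π * Complex.I) := by
  have hball : ∀ z ∈ closedBall (0 : ℂ) ρ, z ∈ ball (0 : ℂ) 1 := fun z hz =>
    closedBall_subset_ball hρ1 hz
  have hdiff : ∀ s : Multiset ℂ, DifferentiableOn ℂ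
      (fun z => (s.map fun a => z - a).prod * h z) (ball 0 1) := by
    intro s
    induction s using Multiset.induction with
    | empty => simpa using hh
    | cons a s ih =>
      have : (fun z => ((a ::ₘ s).map fun a => z - a).prod * h z) =
          fun z => (z - a) * ((s.map fun a => z - a).prod * h z) := by
        ext z; simp [mul_assoc]
      rw [this]
      exact (differentiableOn_id.sub_const a).mul ih
  have hne : ∀ s : Multiset ℂ, (∀ a ∈ s, ‖a‖ ≠ ρ) → ∀ z ∈ sphere (0 : ℂ) ρ,
      (s.map fun a => z - a).prod * h z ≠ 0 := by
    intro s hs z hz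
    refine mul_ne_zero (Multiset.prod_ne_zero ?_) (h0 z (hball z (sphere_subset_closedBall hz)))
    simp only [Multiset.mem_map, not_exists, not_and]
    intro a ha hza
    rw [sub_eq_zero] at hza
    subst hza
    exact hs z ha (by simpa using hz)
  induction s using Multiset.induction with
  | empty =>
    simp only [Multiset.map_zero, Multiset.prod_zero, one_mul, Multiset.filter_zero,
      Multiset.card_zero, Nat.cast_zero, zero_mul]
    refine Complex.circleIntegral_eq_zero_of_differentiable_on_off_countable hρ
      countable_empty ?_ fun z hz => ?_
    · exact ((hh.deriv isOpen_ball).continuousOn.mono hball).div (hh.continuousOn.mono hball)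
        fun z hz => h0 z (hball z hz)
    · have hz1 := hball z (ball_subset_closedBall hz.1)
      exact ((hh.deriv isOpen_ball).differentiableAt (isOpen_ball.mem_nhds hz1)).div
        (hh.differentiableAt (isOpen_ball.mem_nhds hz1)) (h0 z hz1)
  | cons a s ih =>
    have hs' : ∀ b ∈ s, ‖b‖ ≠ ρ := fun b hb => hs b (Multiset.mem_cons_of_mem hb)
    have ha : ‖a‖ ≠ ρ := hs a (Multiset.mem_cons_self a s)
    have hza : ∀ z ∈ sphere (0 : ℂ) ρ, z - a ≠ 0 := by
      intro z hz hza
      rw [sub_eq_zero] at hza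
      subst hza
      exact ha (by simpa using hz)
    have hsub : sphere (0 : ℂ) ρ ⊆ ball 0 1 := fun z hz => hball z (sphere_subset_closedBall hz)
    have h1 : EqOn (logDeriv fun z => ((a ::ₘ s).map fun a => z - a).prod * h z)
        (fun z => (z - a)⁻¹ + logDeriv (fun z => (s.map fun a => z - a).prod * h z) z)
        (sphere 0 ρ) := by
      intro z hz
      have : (fun z => ((a ::ₘ s).map fun a => z - a).prod * h z) =
          fun z => (z - a) * ((s.map fun a => z - a).prod * h z) := by
        ext z; simp [mul_assoc]
      rw [this, logDeriv_mul z (hza z hz) (hne s hs' z hz) (by fun_prop)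
        ((hdiff s).differentiableAt (isOpen_ball.mem_nhds (hsub hz)))]
      simp [logDeriv_apply]
    -- The new factor adds the integral of `1 / (z - a)`, which is `2πi` if `a` lies inside the
    -- circle and `0` by Cauchy's theorem if it lies outside.
    rw [circleIntegral.integral_congr hρ h1, circleIntegral.integral_add, ih hs']
    · by_cases har : ‖a‖ < ρ
      · rw [circleIntegral.integral_sub_inv_of_mem_ball (by simpa using har),
          Multiset.filter_cons_of_pos (p := fun a : ℂ => ‖a‖ < ρ) s har, Multiset.card_cons]
        push_cast; ring
      · rw [Multiset.filter_cons_of_neg (p := fun a : ℂ => ‖a‖ < ρ) s har]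
        have : (∮ z in C(0, ρ), (z - a)⁻¹) = 0 := by
          have hc : ∀ z ∈ closedBall (0 : ℂ) ρ, z - a ≠ 0 := by
            intro z hz hza
            rw [sub_eq_zero] at hza
            subst hza
            exact ha (le_antisymm (by simpa using hz) (not_lt.1 har))
          refine Complex.circleIntegral_eq_zero_of_differentiable_on_off_countable hρ
            countable_empty ?_ fun z hz => ?_
          · exact ContinuousOn.inv₀ (by fun_prop) hc
          · exact DifferentiableAt.inv (by fun_prop) (hc z (ball_subset_closedBall hz.1))
        rw [this, zero_add]
    · refine ContinuousOn.circleIntegrable hρ ?_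
      exact ContinuousOn.inv₀ (by fun_prop) hza
    · refine ContinuousOn.circleIntegrable hρ ?_
      exact (((hdiff s).deriv isOpen_ball).continuousOn.mono hsub).div
        ((hdiff s).continuousOn.mono hsub) (hne s hs')

theorem eval_eq_prod_sub {p : Polynomial ℂ} (hp : p.Monic) (z : ℂ) :
    p.eval z = (p.roots.map fun a => z - a).prod := by
  conv_lhs => rw [(IsAlgClosed.splits p).eq_prod_roots_of_monic hp]
  simp [Polynomial.eval_multiset_prod, Multiset.map_map]

theorem card_roots_eq_natDegree (p : Polynomial ℂ) : p.roots.card = p.natDegree :=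
  ((IsAlgClosed.splits p).natDegree_eq_card_roots).symm

namespace IsRoterFactorization

variable {φ : ℂ → ℂ} {z₀ : ℂ} {p : Polynomial ℂ} {h : ℂ → ℂ}

theorem norm_lt_one_of_mem_roots (H : IsRoterFactorization φ z₀ p h) {a : ℂ}
    (ha : a ∈ p.roots) : ‖a‖ < 1 := by
  simpa using H.root_mem a (Polynomial.isRoot_of_mem_roots ha)

theorem exists_radius (H : IsRoterFactorization φ z₀ p h) :
    ∃ ρ : ℝ, 0 < ρ ∧ ρ < 1 ∧ ∀ a ∈ p.roots, ‖a‖ < ρ := by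
  have h1 : ∀ᶠ ρ in nhdsWithin (1 : ℝ) (Iio 1), ∀ a ∈ p.roots.toFinset, ‖a‖ < ρ := by
    rw [Filter.eventually_all_finset]
    intro a ha
    filter_upwards [Ioo_mem_nhdsLT (H.norm_lt_one_of_mem_roots (Multiset.mem_toFinset.1 ha))]
      with ρ hρ using hρ.1
  obtain ⟨ρ, h2, h3⟩ := (h1.and (Ioo_mem_nhdsLT (zero_lt_one' ℝ))).exists
  exact ⟨ρ, h3.1, h3.2, fun a ha => h2 a (Multiset.mem_toFinset.2 ha)⟩

/-- The argument principle for `φ - φ z₀`, in terms of its roter factorization. -/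
theorem circleIntegral_eq (H : IsRoterFactorization φ z₀ p h) {ρ : ℝ} (hρ : 0 ≤ ρ) (hρ1 : ρ < 1)
    (hs : ∀ a ∈ p.roots, ‖a‖ ≠ ρ) :
    (∮ z in C(0, ρ), deriv φ z / (φ z - φ z₀)) =
      (p.roots.filter fun a => ‖a‖ < ρ).card * (2 * π * Complex.I) := by
  rw [← circleIntegral_logDeriv_prod_mul H.differentiableOn H.ne_zero hρ hρ1 _ hs]
  refine circleIntegral.integral_congr hρ fun z hz => ?_
  have hz1 : z ∈ ball (0 : ℂ) 1 := closedBall_subset_ball hρ1 (sphere_subset_closedBall hz)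
  -- The factorization holds only on the disc, but the logarithmic derivative depends only on the
  -- germ at `z`.
  have h1 : (fun z => (p.roots.map fun a => z - a).prod * h z) =ᶠ[nhds z]
      fun z => φ z - φ z₀ := by
    filter_upwards [isOpen_ball.mem_nhds hz1] with w hw
    rw [H.eq_mul w hw, eval_eq_prod_sub H.monic]
  rw [(logDeriv_congr_nhds h1).eq_of_nhds]
  simp [logDeriv_apply, deriv_sub_const]

end IsRoterFactorization

/-- A folder function is a proper map onto its image: near the unit circle it stays away from each
of its values. -/
theorem IsFolder.exists_le_norm_sub {m : ℕ} {φ : ℂ → ℂ} (hf : IsFolder m φ) {z₀ : ℂ}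
    (hz₀ : z₀ ∈ ball (0 : ℂ) 1) :
    ∃ ε > 0, ∃ ρ < 1, ∀ z ∈ ball (0 : ℂ) 1, ρ ≤ ‖z‖ → ε ≤ ‖φ z - φ z₀‖ := by
  obtain ⟨p, h, H, hp⟩ := hf.factorization z₀ hz₀
  obtain ⟨ρ, hρ, hρ1, hroots⟩ := H.exists_radius
  have hsub : sphere (0 : ℂ) ρ ⊆ ball 0 1 := fun z hz =>
    closedBall_subset_ball hρ1 (sphere_subset_closedBall hz)
  have hφc : ContinuousOn φ (sphere 0 ρ) := hf.differentiableOn.continuousOn.mono hsub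
  have hdc : ContinuousOn (deriv φ) (sphere 0 ρ) :=
    (hf.differentiableOn.deriv isOpen_ball).continuousOn.mono hsub
  have hne : ∀ z ∈ sphere (0 : ℂ) ρ, φ z - φ z₀ ≠ 0 := by
    intro z hz
    rw [H.eq_mul z (hsub hz)]
    refine mul_ne_zero (fun hr => ?_) (H.ne_zero z (hsub hz))
    have := hroots z ((Polynomial.mem_roots H.monic.ne_zero).2 hr)
    simp only [mem_sphere_iff_norm, sub_zero] at hz
    exact this.ne hz
  obtain ⟨δ, hδ, hδφ⟩ : ∃ δ > 0, ∀ z ∈ sphere (0 : ℂ) ρ, δ ≤ ‖φ z - φ z₀‖ := by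
    obtain ⟨w, hw, hmin⟩ := (isCompact_sphere (0 : ℂ) ρ).exists_isMinOn
      ((NormedSpace.sphere_nonempty (E := ℂ)).2 hρ.le) (ContinuousOn.sub hφc continuousOn_const).norm
    exact ⟨‖φ w - φ z₀‖, norm_pos_iff.2 (hne w hw), isMinOn_iff.1 hmin⟩
  obtain ⟨B, hB⟩ := (isCompact_sphere (0 : ℂ) ρ).exists_bound_of_continuousOn hdc
  have hB' : ∀ z ∈ sphere (0 : ℂ) ρ, ‖deriv φ z‖ ≤ |B| := fun z hz =>
    (hB z hz).trans (le_abs_self B)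
  -- If `|φ z₁ - φ z₀| < η`, the first bound keeps `φ - φ z₁` at least `δ / 2` in modulus on the
  -- circle. The second makes the two logarithmic derivatives differ by at most `1 / 2` there, too
  -- little to change an integer zero count.
  set η : ℝ := min (δ / 2) (δ ^ 2 / (4 * (|B| + 1))) with hη
  have hη0 : 0 < η := by positivity
  refine ⟨η, hη0, ρ, hρ1, fun z₁ hz₁ hz₁ρ => ?_⟩
  by_contra! hlt
  obtain ⟨q, k, K, hq⟩ := hf.factorization z₁ hz₁
  have hδ2 : ∀ z ∈ sphere (0 : ℂ) ρ, δ / 2 ≤ ‖φ z - φ z₁‖ := by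
    intro z hz
    have h1 := hδφ z hz
    have h2 := norm_sub_norm_le (φ z - φ z₀) (φ z₁ - φ z₀)
    have h3 : φ z - φ z₀ - (φ z₁ - φ z₀) = φ z - φ z₁ := by ring
    rw [h3] at h2
    have h4 := hlt.trans_le (min_le_left _ _)
    linarith
  have hne1 : ∀ z ∈ sphere (0 : ℂ) ρ, φ z - φ z₁ ≠ 0 := fun z hz =>
    norm_pos_iff.1 ((half_pos hδ).trans_le (hδ2 z hz))
  have hqroots : ∀ a ∈ q.roots, ‖a‖ ≠ ρ := by
    intro a ha haρ
    refine hne1 a (by simpa using haρ) ?_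
    rw [K.eq_mul a (by simpa using K.norm_lt_one_of_mem_roots ha),
      (Polynomial.isRoot_of_mem_roots ha).eq_zero, zero_mul]
  have I0 := H.circleIntegral_eq hρ.le hρ1 fun a ha => (hroots a ha).ne
  have I1 := K.circleIntegral_eq hρ.le hρ1 hqroots
  rw [Multiset.filter_eq_self.2 hroots, card_roots_eq_natDegree, hp] at I0
  -- `φ - φ z₁` also has exactly `m` zeros in the disc, and one of them, `z₁` itself, is not inside
  -- the circle.
  have hcard : (q.roots.filter fun a => ‖a‖ < ρ).card < m := by
    rw [← hq, ← card_roots_eq_natDegree q]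
    refine Multiset.card_lt_card ((Multiset.filter_le _ _).lt_of_ne fun he => ?_)
    have hz1r : z₁ ∈ q.roots := by
      rw [Polynomial.mem_roots K.monic.ne_zero]
      have := K.eq_mul z₁ hz₁
      rw [sub_self, eq_comm, mul_eq_zero] at this
      exact this.resolve_right (K.ne_zero z₁ hz₁)
    exact absurd (Multiset.filter_eq_self.1 he z₁ hz1r) hz₁ρ.not_gt
  set c := (q.roots.filter fun a => ‖a‖ < ρ).card
  have hd : ‖(∮ z in C(0, ρ), deriv φ z / (φ z - φ z₀)) -
      ∮ z in C(0, ρ), deriv φ z / (φ z - φ z₁)‖ ≤ 2 * π * ρ * (1 / 2) := by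
    rw [← circleIntegral.integral_sub]
    · refine circleIntegral.norm_integral_le_of_norm_le_const hρ.le fun z hz => ?_
      -- Over the common denominator the numerator is at most `δ² / 4` in modulus, and the
      -- denominator at least `δ² / 2`.
      rw [div_sub_div _ _ (hne z hz) (hne1 z hz)]
      have h3 : deriv φ z * (φ z - φ z₁) - (φ z - φ z₀) * deriv φ z =
        - (deriv φ z * (φ z₁ - φ z₀)) := by ring
      rw [h3, norm_div, norm_neg, norm_mul, norm_mul]
      have h1 := hδφ z hz
      have h2 := hδ2 z hz
      have h4 := hB' z hz
      rw [div_le_iff₀ (mul_pos (norm_pos_iff.2 (hne z hz)) (norm_pos_iff.2 (hne1 z hz)))]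
      have h5 : δ * (δ / 2) ≤ ‖φ z - φ z₀‖ * ‖φ z - φ z₁‖ := by gcongr
      have h6 : ‖deriv φ z‖ * ‖φ z₁ - φ z₀‖ ≤ (|B| + 1) * (δ ^ 2 / (4 * (|B| + 1))) := by
        gcongr
        · linarith
        · exact hlt.le.trans (min_le_right _ _)
      have h7 : (|B| + 1) * (δ ^ 2 / (4 * (|B| + 1))) = δ ^ 2 / 4 := by
        field_simp
      nlinarith
    · exact ContinuousOn.circleIntegrable hρ.le (hdc.div (ContinuousOn.sub hφc continuousOn_const) hne)
    · exact ContinuousOn.circleIntegrable hρ.le (hdc.div (ContinuousOn.sub hφc continuousOn_const) hne1)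
  rw [I0, I1, ← sub_mul, norm_mul] at hd
  have hpi : ‖(2 * π * Complex.I : ℂ)‖ = 2 * π := by
    simp [abs_of_pos Real.pi_pos]
  have h1 : (1 : ℝ) ≤ ‖(m : ℂ) - c‖ := by
    have : (m : ℂ) - c = ((m - c : ℕ) : ℂ) := by rw [Nat.cast_sub hcard.le]
    rw [this, Complex.norm_natCast]
    exact_mod_cast Nat.sub_pos_of_lt hcard
  rw [hpi] at hd
  have := Real.pi_pos
  -- Distinct zero counts would force `2π ≤ πρ`, impossible for `ρ < 1`.
  nlinarith

/-! ### Bounded analytic functions and products of multiplication operators. -/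

theorem IsHInfty.of_differentiable {f : ℂ → ℂ} (hf : Differentiable ℂ f) : IsHInfty f where
  differentiableOn := hf.differentiableOn
  bounded := by
    obtain ⟨C, hC⟩ := (isCompact_closedBall (0 : ℂ) 1).exists_bound_of_continuousOn
      hf.continuous.continuousOn
    exact ⟨C, fun z hz => hC z (ball_subset_closedBall hz)⟩

/-- A continuous function on the disc that is bounded near the unit circle is bounded. -/
theorem IsHInfty.of_bounded_near {f : ℂ → ℂ} (hf : DifferentiableOn ℂ f (ball 0 1)) {ρ C : ℝ}
    (hρ : ρ < 1) (hC : ∀ z ∈ ball (0 : ℂ) 1, ρ ≤ ‖z‖ → ‖f z‖ ≤ C) : IsHInfty f where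
  differentiableOn := hf
  bounded := by
    obtain ⟨D, hD⟩ := (isCompact_closedBall (0 : ℂ) ρ).exists_bound_of_continuousOn
      (hf.continuousOn.mono (closedBall_subset_ball hρ))
    refine ⟨max C D, fun z hz => ?_⟩
    rcases le_total ρ ‖z‖ with h | h
    · exact (hC z hz h).trans (le_max_left _ _)
    · exact (hD z (by simpa using h)).trans (le_max_right _ _)

theorem mulOp_comp {f g k : ℂ → ℂ} (hf : IsHInfty f) (hg : IsHInfty g) (hk : IsHInfty k)
    (h : ∀ z ∈ ball (0 : ℂ) 1, k z = f z * g z) : mulOp k hk = mulOp f hf ∘L mulOp g hg := by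
  ext1 u
  refine H2.ext_ball fun z hz => ?_
  simp [h z hz, mul_assoc]

theorem mulOp_one {f : ℂ → ℂ} (hf : IsHInfty f) (h : ∀ z ∈ ball (0 : ℂ) 1, f z = 1) :
    mulOp f hf = ContinuousLinearMap.id ℂ H2 := by
  ext1 u
  refine H2.ext_ball fun z hz => ?_
  simp [h z hz]

/-! ### Reproducing kernels and monomials. -/

namespace H2

theorem inner_eq (f g : H2) : inner ℂ f g = inner ℂ (toSeq f) (toSeq g) := rfl

theorem toSeq_apply (f : H2) (n : ℕ) : toSeq f n = f.coeff n := rfl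

theorem toSeq_symm (a : lp (fun _ : ℕ => ℂ) 2) : toSeq (toSeqEquiv.symm a) = a :=
  toSeqEquiv.apply_symm_apply a

/-- The reproducing kernel of `H²(𝔻)` at `a`. -/
noncomputable def kernel (a : ℂ) (ha : ‖a‖ < 1) : H2 :=
  toSeqEquiv.symm ⟨fun n => (starRingEnd ℂ) a ^ n, summable_sq_iff.1 (by
    have : Summable fun n : ℕ => (‖a‖ ^ 2) ^ n :=
      summable_geometric_of_lt_one (by positivity) (by nlinarith [norm_nonneg a])
    refine this.congr fun n => ?_
    simp [← pow_mul, mul_comm])⟩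

theorem coeff_kernel (a : ℂ) (ha : ‖a‖ < 1) (n : ℕ) :
    (kernel a ha).coeff n = (starRingEnd ℂ) a ^ n := by
  rw [← toSeq_apply, kernel, toSeq_symm]

/-- The inner product is conjugate-linear on the left, so the coefficients `conj a ^ n` of the
kernel turn into the Taylor series at `a`. -/
theorem inner_kernel (a : ℂ) (ha : ‖a‖ < 1) (f : H2) : inner ℂ (kernel a ha) f = f a := by
  have h1 := lp.hasSum_inner (𝕜 := ℂ) (toSeq (kernel a ha)) (toSeq f)
  refine (h1.unique ?_)
  simp only [toSeq_apply, coeff_kernel]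
  have h2 := f.hasCoeff a (by simpa using ha)
  simpa using h2

theorem kernel_ne_zero (a : ℂ) (ha : ‖a‖ < 1) : kernel a ha ≠ 0 := by
  intro h
  have h1 := coeff_kernel a ha 0
  have h2 : toSeq (kernel a ha) 0 = 0 := by rw [h, map_zero]; rfl
  rw [toSeq_apply, h1] at h2
  simp at h2

/-- The monomial `zⁿ`. -/
noncomputable def monomial (n : ℕ) : H2 := toSeqEquiv.symm (lp.single 2 n 1)

theorem toSeq_monomial (n : ℕ) : toSeq (monomial n) = lp.single 2 n 1 := toSeq_symm _

theorem inner_monomial (f : H2) (n : ℕ) : inner ℂ (monomial n) f = f.coeff n := by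
  rw [inner_eq, toSeq_monomial, lp.inner_single_left]
  simp [toSeq_apply]

theorem monomial_apply (n : ℕ) {z : ℂ} (hz : z ∈ ball (0 : ℂ) 1) : monomial n z = z ^ n := by
  rw [← inner_kernel z (by simpa using hz), ← inner_conj_symm, inner_monomial, coeff_kernel]
  simp

end H2

/-! ### The adjoint of multiplication by a linear factor. -/

theorem isHInfty_sub (a : ℂ) : IsHInfty fun z => z - a := .of_differentiable (by fun_prop)

theorem HasCoeff.id_mul {f : ℂ → ℂ} {a : ℕ → ℂ} (h : HasCoeff f a) :
    HasCoeff (fun z => z * f z) fun n => Nat.casesOn n 0 a := by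
  intro z hz
  rw [← hasSum_nat_add_iff' 1]
  simpa [pow_succ', mul_left_comm] using (h z hz).mul_left z

/-- Multiplication by `z` shifts the Taylor coefficients, hence preserves their square sum. -/
theorem norm_le_norm_mulOp_id (hz : IsHInfty fun z => z) (f : H2) : ‖f‖ ≤ ‖mulOp _ hz f‖ := by
  have hc := (mulOp _ hz f).hasCoeff.unique (f.hasCoeff.id_mul)
  have h1 : ‖mulOp _ hz f‖ ^ 2 = ‖f‖ ^ 2 := by
    rw [H2.norm_sq_eq_tsum, H2.norm_sq_eq_tsum, (mulOp _ hz f).summable_coeff.tsum_eq_zero_add]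
    simp [hc]
  exact ((pow_left_inj₀ (norm_nonneg _) (norm_nonneg _) two_ne_zero).1 h1).ge

theorem le_norm_mulOp_sub (a : ℂ) (f : H2) :
    (1 - ‖a‖) * ‖f‖ ≤ ‖mulOp _ (isHInfty_sub a) f‖ := by
  have hz : IsHInfty fun z => z := .of_differentiable differentiable_id
  have h1 : mulOp _ (isHInfty_sub a) f = mulOp _ hz f - a • f := by
    rw [eq_sub_iff_add_eq]
    refine H2.ext_ball fun z _ => ?_
    simp only [H2.add_apply, mulOp_apply, H2.smul_apply]; ring
  have h2 := norm_sub_norm_le (mulOp _ hz f) (a • f)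
  rw [norm_smul] at h2
  rw [h1]
  linarith [norm_le_norm_mulOp_id hz f]

/-- The bound makes `S^* S` coercive, since its quadratic form is `‖S x‖²`, and hence invertible;
then `S (S^* S)⁻¹ y` is a preimage of `y` under `S^*`. -/
theorem surjective_adjoint_of_bound {E : Type*} [NormedAddCommGroup E] [InnerProductSpace ℂ E]
    [CompleteSpace E] (S : E →L[ℂ] E) {c : ℝ} (hc : 0 < c) (h : ∀ x, c * ‖x‖ ≤ ‖S x‖) :
    Function.Surjective (ContinuousLinearMap.adjoint S) := by
  have hu : IsUnit (ContinuousLinearMap.adjoint S ∘L S) := by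
    refine ContinuousLinearMap.isUnit_of_forall_le_norm_inner_map _
      (c := ⟨c ^ 2, sq_nonneg c⟩) (show (0 : ℝ) < c ^ 2 by positivity) fun x => ?_
    rw [ContinuousLinearMap.comp_apply, ContinuousLinearMap.adjoint_inner_left,
      inner_self_eq_norm_sq_to_K]
    have : ‖x‖ ^ 2 * c ^ 2 ≤ ‖S x‖ ^ 2 := by
      rw [← mul_pow, mul_comm]
      exact pow_le_pow_left₀ (by positivity) (h x) 2
    refine this.trans_eq ?_
    simp
  obtain ⟨u, hu⟩ := hu
  intro y
  refine ⟨S (u⁻¹.1 y), ?_⟩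
  have h1 : (u.1 * u⁻¹.1) y = y := by rw [u.mul_inv]; rfl
  rw [hu] at h1
  exact h1

theorem surjective_adjoint_mulOp_sub {a : ℂ} (ha : ‖a‖ < 1) :
    Function.Surjective (ContinuousLinearMap.adjoint (mulOp _ (isHInfty_sub a))) :=
  surjective_adjoint_of_bound _ (sub_pos.2 ha) (le_norm_mulOp_sub a)

theorem rank_ker_adjoint_mulOp_sub {a : ℂ} (ha : ‖a‖ < 1) :
    Module.rank ℂ (ContinuousLinearMap.adjoint (mulOp _ (isHInfty_sub a))).ker = 1 := by
  rw [rank_submodule_eq_one_iff]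
  refine ⟨H2.kernel a ha, ?_, H2.kernel_ne_zero a ha, fun g hg => ?_⟩
  · rw [LinearMap.mem_ker]
    refine ext_inner_right ℂ fun f => ?_
    rw [ContinuousLinearMap.coe_coe, ContinuousLinearMap.adjoint_inner_left, H2.inner_kernel]
    simp
  -- Pairing the kernel equation with `zⁿ` gives a geometric recursion for the coefficients, so `g`
  -- is determined by its constant term.
  · have h1 : ∀ n, g.coeff (n + 1) = (starRingEnd ℂ) a * g.coeff n := by
      intro n
      have h2 : mulOp _ (isHInfty_sub a) (H2.monomial n) =
          H2.monomial (n + 1) - a • H2.monomial n := by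
        rw [eq_sub_iff_add_eq]
        refine H2.ext_ball fun z hz => ?_
        simp only [H2.add_apply, mulOp_apply, H2.smul_apply, H2.monomial_apply _ hz]; ring
      have h3 : inner ℂ (H2.monomial n)
          (ContinuousLinearMap.adjoint (mulOp _ (isHInfty_sub a)) g) = 0 := by
        rw [show ContinuousLinearMap.adjoint (mulOp _ (isHInfty_sub a)) g = 0 from hg,
          inner_zero_right]
      rw [ContinuousLinearMap.adjoint_inner_right, h2, inner_sub_left, inner_smul_left,
        H2.inner_monomial, H2.inner_monomial] at h3
      exact sub_eq_zero.1 h3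
    have h4 : ∀ n, g.coeff n = g.coeff 0 * (starRingEnd ℂ) a ^ n := by
      intro n
      induction n with
      | zero => simp
      | succ n ih => rw [h1, ih]; ring
    rw [Submodule.mem_span_singleton]
    refine ⟨g.coeff 0, H2.toSeq_injective (Subtype.ext (funext fun n => ?_))⟩
    change ((g.coeff 0) • H2.kernel a ha).coeff n = g.coeff n
    rw [H2.coeff_smul, Pi.smul_apply, H2.coeff_kernel, h4 n, smul_eq_mul]

/-! ### The adjoint of multiplication by a polynomial. -/

/-- `T` maps the kernel of the composite onto `ker S`, by surjectivity, and the kernel of this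
restriction is `ker T`; rank-nullity concludes. -/
theorem rank_ker_comp_of_surjective {V X : Type*} [AddCommGroup V] [Module ℂ V]
    [AddCommGroup X] [Module ℂ X]
    (S : V →ₗ[ℂ] X) {T : V →ₗ[ℂ] V} (hT : Function.Surjective T) :
    Module.rank ℂ (S ∘ₗ T).ker = Module.rank ℂ S.ker + Module.rank ℂ T.ker := by
  have hmem : ∀ x ∈ (S ∘ₗ T).ker, T x ∈ S.ker := fun x hx => hx
  set R : (S ∘ₗ T).ker →ₗ[ℂ] S.ker := T.restrict hmem
  have hR : Function.Surjective R := by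
    rintro ⟨y, hy⟩
    obtain ⟨x, rfl⟩ := hT y
    exact ⟨⟨x, hy⟩, rfl⟩
  rw [← LinearMap.rank_range_add_rank_ker R, LinearMap.range_eq_top.2 hR, rank_top]
  congr 1
  refine LinearEquiv.rank_eq (LinearEquiv.ofBijective
    (LinearMap.codRestrict T.ker ((S ∘ₗ T).ker.subtype ∘ₗ R.ker.subtype) ?_) ⟨?_, ?_⟩)
  · rintro ⟨⟨x, hx⟩, hx'⟩
    exact congrArg Subtype.val hx'
  · intro x y hxy
    exact Subtype.ext (Subtype.ext (by
      have := congrArg (fun v : T.ker => (v : V)) hxy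
      exact this))
  · rintro ⟨x, hx⟩
    refine ⟨⟨⟨x, ?_⟩, ?_⟩, rfl⟩
    · rw [LinearMap.mem_ker] at hx
      simp [hx]
    · exact Subtype.ext hx

/-- Multiplication by a product of `n` linear factors with zeros in the disc has a surjective
adjoint, with a kernel of dimension `n`. -/
theorem adjoint_mulOp_prod_sub (s : Multiset ℂ) (hs : ∀ a ∈ s, ‖a‖ < 1) {f : ℂ → ℂ}
    (hf : IsHInfty f) (hfs : ∀ z, f z = (s.map fun a => z - a).prod) :
    Function.Surjective (ContinuousLinearMap.adjoint (mulOp f hf)) ∧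
      Module.rank ℂ (ContinuousLinearMap.adjoint (mulOp f hf)).ker = s.card := by
  induction s using Multiset.induction generalizing f with
  | empty =>
    rw [mulOp_one hf fun z _ => by simp [hfs], ← ContinuousLinearMap.one_def]
    rw [← ContinuousLinearMap.star_eq_adjoint, star_one]
    refine ⟨Function.surjective_id, ?_⟩
    rw [(LinearMap.ker_eq_bot).2]
    · simp
    · exact Function.injective_id
  | cons a s ih =>
    have hd : Differentiable ℂ fun z : ℂ => (s.map fun a => z - a).prod := by
      clear * -
      induction s using Multiset.induction with
      | empty => simp
      | cons a s ih =>
        simp only [Multiset.map_cons, Multiset.prod_cons]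
        exact (differentiable_id.sub_const a).mul ih
    obtain ⟨h1, h2⟩ := ih (fun b hb => hs b (Multiset.mem_cons_of_mem hb))
      (.of_differentiable hd) fun z => rfl
    have ha := hs a (Multiset.mem_cons_self a s)
    have h3 := surjective_adjoint_mulOp_sub ha
    rw [mulOp_comp (isHInfty_sub a) (.of_differentiable hd) hf fun z _ => by simp [hfs],
      ContinuousLinearMap.adjoint_comp]
    refine ⟨h1.comp h3, ?_⟩
    rw [ContinuousLinearMap.toLinearMap_comp]
    rw [rank_ker_comp_of_surjective _ h3, h2, rank_ker_adjoint_mulOp_sub ha, Multiset.card_cons]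
    push_cast; rfl

/-! ### Roter functions are invertible in `H^∞`. -/

theorem pow_card_le_norm_prod_sub {s : Multiset ℂ} {r : ℝ} (hs : ∀ a ∈ s, ‖a‖ < r) {d : ℝ}
    (hd : 0 ≤ d) {z : ℂ} (hz : r + d ≤ ‖z‖) : d ^ s.card ≤ ‖(s.map fun a => z - a).prod‖ := by
  induction s using Multiset.induction with
  | empty => simp
  | cons a s ih =>
    rw [Multiset.card_cons, Multiset.map_cons, Multiset.prod_cons, norm_mul, pow_succ']
    have h1 := norm_sub_norm_le z a
    have h2 := hs a (Multiset.mem_cons_self a s)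
    exact mul_le_mul (by linarith) (ih fun b hb => hs b (Multiset.mem_cons_of_mem hb))
      (pow_nonneg hd _) (norm_nonneg _)

theorem IsRoterFactorization.isHInfty {φ : ℂ → ℂ} {z₀ : ℂ} {p : Polynomial ℂ} {h : ℂ → ℂ}
    (H : IsRoterFactorization φ z₀ p h) (hsub : IsHInfty fun z => φ z - φ z₀) : IsHInfty h := by
  obtain ⟨r, hr, hr1, hroots⟩ := H.exists_radius
  obtain ⟨C, hC⟩ := hsub.bounded
  -- Beyond the radius midway between `r` and `1`, every root is at distance at least `(1 - r) / 2`,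
  -- which bounds `|p|` from below.
  have hd : 0 < (1 - r) / 2 := by linarith
  refine .of_bounded_near (C := C / ((1 - r) / 2) ^ p.roots.card) (ρ := r + (1 - r) / 2)
    H.differentiableOn (by linarith) fun z hz hzr => ?_
  rw [le_div_iff₀ (pow_pos hd _)]
  refine le_trans ?_ (hC z hz)
  rw [H.eq_mul z hz, norm_mul, mul_comm, eval_eq_prod_sub H.monic]
  exact mul_le_mul_of_nonneg_right (pow_card_le_norm_prod_sub hroots hd.le hzr) (norm_nonneg _)

/-- Near the circle `|p h|` is at least `ε` by properness, while `|p|` is at most `P`, so `1 / |h|`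
is at most `P / ε`. -/
theorem IsFolder.isHInfty_inv {m : ℕ} {φ : ℂ → ℂ} (hf : IsFolder m φ) {z₀ : ℂ}
    (hz₀ : z₀ ∈ ball (0 : ℂ) 1) {p : Polynomial ℂ} {h : ℂ → ℂ}
    (H : IsRoterFactorization φ z₀ p h) : IsHInfty fun z => (h z)⁻¹ := by
  obtain ⟨ε, hε, ρ, hρ, hbelow⟩ := hf.exists_le_norm_sub hz₀
  obtain ⟨P, hP⟩ := (IsHInfty.of_differentiable p.differentiable).bounded
  refine .of_bounded_near (C := P / ε) (H.differentiableOn.inv H.ne_zero) hρ fun z hz hzr => ?_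
  have h1 := hbelow z hz hzr
  rw [H.eq_mul z hz, norm_mul] at h1
  rw [norm_inv, inv_eq_one_div, div_le_div_iff₀ (norm_pos_iff.2 (H.ne_zero z hz)) hε, one_mul]
  exact h1.trans (mul_le_mul_of_nonneg_right (hP z hz) (norm_nonneg _))

/-! ### Range and kernel of the adjoint of multiplication by `φ - φ z₀`. -/

theorem adjoint_mulOp_adjoint_mulOp {f g : ℂ → ℂ} (hf : IsHInfty f) (hg : IsHInfty g)
    (hfg : ∀ z ∈ ball (0 : ℂ) 1, g z * f z = 1) (u : H2) :
    ContinuousLinearMap.adjoint (mulOp f hf) (ContinuousLinearMap.adjoint (mulOp g hg) u) = u := by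
  refine ext_inner_right ℂ fun v => ?_
  rw [ContinuousLinearMap.adjoint_inner_left, ContinuousLinearMap.adjoint_inner_left]
  congr 1
  refine H2.ext_ball fun z hz => ?_
  rw [mulOp_apply, mulOp_apply, ← mul_assoc, hfg z hz, one_mul]

/-- For a bounded folder function, the adjoint of `M_φ - φ z₀` is surjective and the dimension of
its kernel is the number of roots of `φ - φ z₀`. -/
theorem IsFolder.adjoint_mulOp_sub {m : ℕ} {φ : ℂ → ℂ} (hf : IsFolder m φ) {z₀ : ℂ}
    (hz₀ : z₀ ∈ ball (0 : ℂ) 1) (hsub : IsHInfty fun z => φ z - φ z₀) :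
    Function.Surjective (ContinuousLinearMap.adjoint (mulOp _ hsub)) ∧
      Module.rank ℂ (ContinuousLinearMap.adjoint (mulOp _ hsub)).ker = m := by
  obtain ⟨p, h, H, hp⟩ := hf.factorization z₀ hz₀
  have hpb : IsHInfty fun z => p.eval z := .of_differentiable p.differentiable
  have hh : IsHInfty h := H.isHInfty hsub
  have hi : IsHInfty fun z => (h z)⁻¹ := hf.isHInfty_inv hz₀ H
  obtain ⟨hsurj, hrank⟩ := adjoint_mulOp_prod_sub p.roots
    (fun a ha => H.norm_lt_one_of_mem_roots ha) hpb (eval_eq_prod_sub H.monic)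
  have hl := adjoint_mulOp_adjoint_mulOp hh hi fun z hz => inv_mul_cancel₀ (H.ne_zero z hz)
  have hr := adjoint_mulOp_adjoint_mulOp hi hh fun z hz => mul_inv_cancel₀ (H.ne_zero z hz)
  have hker : (ContinuousLinearMap.adjoint (mulOp h hh)).ker = ⊥ :=
    LinearMap.ker_eq_bot.2 (Function.LeftInverse.injective hr)
  -- Taking adjoints reverses the order: the surjective `M_p^*` acts first, then the bijective
  -- `M_h^*`, which affects neither surjectivity nor the kernel dimension.
  rw [mulOp_comp hpb hh hsub H.eq_mul, ContinuousLinearMap.adjoint_comp]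
  refine ⟨fun y => ?_, ?_⟩
  · obtain ⟨x, hx⟩ := hsurj (ContinuousLinearMap.adjoint (mulOp _ hi) y)
    exact ⟨x, by rw [ContinuousLinearMap.comp_apply, hx, hl]⟩
  · rw [ContinuousLinearMap.toLinearMap_comp, rank_ker_comp_of_surjective _ hsurj, hrank, hker,
      rank_bot, zero_add, card_roots_eq_natDegree, hp]

theorem IsHInfty.sub_const {φ : ℂ → ℂ} (hφ : IsHInfty φ) (c : ℂ) :
    IsHInfty fun z => φ z - c where
  differentiableOn := hφ.differentiableOn.sub_const c
  bounded := by
    obtain ⟨C, hC⟩ := hφ.bounded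
    exact ⟨C + ‖c‖, fun z hz => (norm_sub_le _ _).trans (by gcongr; exact hC z hz)⟩

theorem adjoint_mulOp_sub_smul {φ : ℂ → ℂ} (hφ : IsHInfty φ) (c : ℂ) :
    ContinuousLinearMap.adjoint (mulOp φ hφ) - (starRingEnd ℂ) c • ContinuousLinearMap.id ℂ H2 =
      ContinuousLinearMap.adjoint (mulOp _ (hφ.sub_const c)) := by
  rw [ContinuousLinearMap.eq_adjoint_iff]
  intro f g
  have h1 : mulOp _ (hφ.sub_const c) g = mulOp φ hφ g - c • g := by
    rw [eq_sub_iff_add_eq]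
    refine H2.ext_ball fun z _ => ?_
    simp only [H2.add_apply, mulOp_apply, H2.smul_apply]; ring
  rw [h1]
  simp [inner_sub_left, inner_sub_right, inner_smul_left, inner_smul_right,
    ContinuousLinearMap.adjoint_inner_left]

/-! ### Eigenvectors and the Cowen-Douglas conditions. -/

theorem kernel_mem_ker {φ : ℂ → ℂ} (hφ : IsHInfty φ) {z₀ : ℂ} (hz₀ : ‖z₀‖ < 1) :
    H2.kernel z₀ hz₀ ∈ (ContinuousLinearMap.adjoint (mulOp φ hφ) -
      (starRingEnd ℂ) (φ z₀) • ContinuousLinearMap.id ℂ H2).ker := by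
  rw [adjoint_mulOp_sub_smul, LinearMap.mem_ker]
  refine ext_inner_right ℂ fun f => ?_
  rw [ContinuousLinearMap.coe_coe, ContinuousLinearMap.adjoint_inner_left, H2.inner_kernel]
  simp

theorem IsFolder.isOpen_conjImage {m : ℕ} {φ : ℂ → ℂ} (hf : IsFolder m φ) :
    IsOpen (conjImage φ) := by
  -- The open mapping theorem; conjugation is a homeomorphism of the plane.
  have h1 : IsOpen (φ '' ball 0 1) := by
    rcases (hf.differentiableOn.analyticOnNhd isOpen_ball).is_constant_or_isOpen
      (convex_ball (0 : ℂ) 1).isPreconnected with ⟨w, hw⟩ | h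
    · obtain ⟨x, hx, y, hy, hxy⟩ := hf.nonconstant
      exact absurd ((hw x hx).trans (hw y hy).symm) hxy
    · exact h _ subset_rfl isOpen_ball
  have h2 := Complex.conjCLE.toHomeomorph.isOpenMap _ h1
  rw [image_image] at h2
  exact h2

theorem isConnected_conjImage {φ : ℂ → ℂ} (hφ : IsHInfty φ) : IsConnected (conjImage φ) :=
  ((convex_ball (0 : ℂ) 1).isConnected ⟨0, by simp⟩).image _
    (Complex.continuous_conj.comp_continuousOn hφ.differentiableOn.continuousOn)

/-- The roter functions of a bounded folder function are invertible in `H^∞(𝔻)`, by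
`IsFolder.exists_le_norm_sub`. In particular they are always outer, so that this need not be
assumed. -/
theorem IsFolder.isCowenDouglas {m : ℕ} {φ : ℂ → ℂ} (hf : IsFolder m φ) (hφ : IsHInfty φ) :
    IsCowenDouglas m (conjImage φ) (ContinuousLinearMap.adjoint (mulOp φ hφ)) where
  isOpen := hf.isOpen_conjImage
  isConnected := isConnected_conjImage hφ
  subset_spectrum := by
    rintro _ ⟨z, hz, rfl⟩
    have hz1 : ‖z‖ < 1 := by simpa using hz
    rw [spectrum.mem_iff]
    intro hu
    have h1 := hu.neg
    rw [neg_sub] at h1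
    obtain ⟨u, hu⟩ := h1
    -- An invertible operator cannot annihilate the nonzero eigenvector.
    have h2 : u.1 (H2.kernel z hz1) = 0 := by
      rw [hu, Algebra.algebraMap_eq_smul_one]
      exact kernel_mem_ker hφ hz1
    have h3 : (u⁻¹.1 * u.1) (H2.kernel z hz1) = H2.kernel z hz1 := by rw [u.inv_mul]; rfl
    rw [mul_apply_eq_comp, h2, map_zero] at h3
    exact H2.kernel_ne_zero z hz1 h3.symm
  range_eq_top := by
    rintro _ ⟨z, hz, rfl⟩
    rw [adjoint_mulOp_sub_smul]
    exact LinearMap.range_eq_top.2 (hf.adjoint_mulOp_sub hz _).1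
  closure_span_ker := by
    -- A subspace of a Hilbert space is dense when its orthogonal complement is trivial;
    -- orthogonality to the reproducing kernel at `z` means vanishing at `z`.
    rw [Submodule.topologicalClosure_eq_top_iff, Submodule.eq_bot_iff]
    intro f hfo
    refine H2.ext_ball fun z hz => ?_
    have hz1 : ‖z‖ < 1 := by simpa using hz
    rw [← H2.inner_kernel z hz1]
    exact (Submodule.mem_orthogonal _ f).1 hfo _
      (Submodule.mem_iSup_of_mem _ (Submodule.mem_iSup_of_mem ⟨z, hz, rfl⟩
        (kernel_mem_ker hφ hz1)))
  rank_ker := by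
    rintro _ ⟨z, hz, rfl⟩
    rw [adjoint_mulOp_sub_smul]
    exact (hf.adjoint_mulOp_sub hz _).2

end Hardy

theorem theorem10 (m : ℕ) (φ : ℂ → ℂ) (hφ : Hardy.IsHInfty φ) (hfold : Hardy.IsFolder m φ)
    (houter : ∀ z₀ ∈ Metric.ball (0 : ℂ) 1, ∀ h : ℂ → ℂ,
      Hardy.IsRoterFunction φ z₀ h → Hardy.IsOuter h) :
    Hardy.IsCowenDouglasFunction φ hφ ∧
      Hardy.IsCowenDouglas m (Hardy.conjImage φ)
        (ContinuousLinearMap.adjoint (Hardy.mulOp φ hφ)) :=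
  ⟨⟨m, hfold.isCowenDouglas hφ⟩, hfold.isCowenDouglas hφ⟩
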